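/- Let $\alpha^f>\alpha\ge 0$ be real parameters and let $(b_l,b_r)\in[0,1]^2$. For $n\ge 1$, put $p_n^f=\alpha^f/n$ and $p_n=\alpha/n$, and consider the random bipartite graph $G_n(b_l,b_r)$ with left nodes $v^l_1,\dots,v^l_n$ and right nodes $v^r_1,\dots,v^r_n$, generated as follows. Independently, each left node is flexible with probability $b_l$ and each right node is flexible with probability $b_r$ (otherwise the node is regular); write $F^l_i,F^r_j\in\{0,1\}$ for the indicators of flexibility. Given these, the edges $(v^l_i,v^r_j)$ are present independently, with probability $2p_n+(F^l_i+F^r_j)(p^f_n-p_n)$ (which lies in $[0,1]$ for all $n\ge 2\alpha^f$; the finitely many smaller $n$ are irrelevant below). Let $\mathcal M_n(b_l,b_r)$ be the size of a maximum matching of $G_n(b_l,b_r)$, let $\mu_n(b_l,b_r)=\mathbb E[\mathcal M_n(b_l,b_r)/n]$, and let $\mu(b_l,b_r)=\limsup_{n\to\infty}\mu_n(b_l,b_r)$. Theorem. If $B=1$ and $\alpha=0$, then $$\mu(B,0)-\mu(B/2,B/2)\;\ge\;\frac{(\alpha^f)^3}{2^5}\,e^{-7\alpha^f}.$$ In particular,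 $\mu(B,0)>\mu(B/2,B/2)$: the one-sided allocation strictly beats the balanced one. -/

import Mathlib

open Filter

noncomputable section

namespace Flexibility

/-- The joint law of independent Bernoulli variables `X i`, where `X i = true` with
probability `p i`. -/
def indepBernoulli {ι : Type} [Fintype ι] [DecidableEq ι] (p : ι → unitInterval) :
    PMF (ι → Bool) :=
  PMF.ofFintype
    (fun x => ∏ i, ENNReal.ofReal (if x i then (p i : ℝ) else 1 - (p i : ℝ)))
    (by
      classical
      have h := Fintype.prod_sum
        (fun (i : ι) (b : Bool) => ENNReal.ofReal (if b then (p i : ℝ) else 1 - (p i : ℝ)))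
      rw [← h]
      refine Finset.prod_eq_one fun i _ => ?_
      rw [Fintype.sum_bool]
      simp only [if_true, Bool.false_eq_true, if_false]
      rw [← ENNReal.ofReal_add (p i).2.1 (sub_nonneg.2 (p i).2.2)]
      simp)

/-- A real number viewed as a probability. Numbers in `[0, 1]` are unchanged; others are
clamped to `[0, 1]`. -/
def toProb (x : ℝ) : unitInterval := Set.projIcc (0 : ℝ) 1 zero_le_one x

/-- The conditional probability of an edge between a left node and a right node with flexibility
indicators `fl` and `fr`: it is `2 pₙ + (fl + fr) (pₙᶠ - pₙ)`, with `pₙᶠ = αf / n` and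
`pₙ = α / n`. For fixed `αf ≥ α ≥ 0` this number lies in `[0, 1]` as soon as `n ≥ 2 αf`, so the
clamping concerns finitely many `n` only. -/
def edgeProb (αf α : ℝ) (n : ℕ) (fl fr : Bool) : unitInterval :=
  toProb (2 * (α / n) +
    ((if fl then (1 : ℝ) else 0) + (if fr then (1 : ℝ) else 0)) * (αf / n - α / n))

/-- The law of the random bipartite graph with `n` nodes on each side. A graph is given by the
indicator `R` of its edges, with `R (i, j) = true` iff the left node `i` and the right node `j` are
adjacent. Left (right) nodes are independently flexible with probability `bl` (`br`), and, given
the flexibility indicators, the edges are independent with probabilities `edgeProb`. -/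
def graphLaw (αf α bl br : ℝ) (n : ℕ) : PMF (Fin n × Fin n → Bool) :=
  (indepBernoulli fun _ : Fin n => toProb bl).bind fun Fl =>
    (indepBernoulli fun _ : Fin n => toProb br).bind fun Fr =>
      indepBernoulli fun e : Fin n × Fin n => edgeProb αf α n (Fl e.1) (Fr e.2)

/-- A matching of the bipartite graph `R`: a set of edges of `R`, no two of which share a node. -/
def IsMatching {n : ℕ} (R : Fin n × Fin n → Bool) (M : Finset (Fin n × Fin n)) : Prop :=
  (∀ e ∈ M, R e = true) ∧
    ∀ e ∈ M, ∀ e' ∈ M, e ≠ e' → e.1 ≠ e'.1 ∧ e.2 ≠ e'.2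

open Classical in
/-- The size of a maximum matching. -/
def maxMatching {n : ℕ} (R : Fin n × Fin n → Bool) : ℕ :=
  (Finset.univ.filter (IsMatching R)).sup Finset.card

/-- The expectation of the maximum matching size divided by `n`. -/
def muN (αf α bl br : ℝ) (n : ℕ) : ℝ :=
  ∑ R : Fin n × Fin n → Bool, (graphLaw αf α bl br n R).toReal * ((maxMatching R : ℝ) / n)

/-- The asymptotic matching probability. Since `0 ≤ muN ≤ 1`, this is a genuine upper limit. -/
def mu (αf α bl br : ℝ) : ℝ := limsup (fun n : ℕ => muN αf α bl br n) atTop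

end Flexibility

end

/-! Write c for αf. The one-sided graph has every edge probability equal to c/n. In the balanced
graph the probability is (F i + G j) c/n, which has the same mean but is correlated along rows and
columns. The claim is that this correlation hurts: two edges at a common node are substitutes,
because a matching uses at most one of them.

The proof interpolates, giving the pairs the deterministic probability c/n one at a time
(`hybridMatching`). For the pair (i, j) the change in probability is (1 - F i - G j) c/n, which
vanishes unless both end nodes are regular or both are flexible. The increment is therefore c/(4n)
times the loss in marginal value of (i, j) when both ends become flexible (`hybridMatching_insert`).
The loss is nonnegative by substitutability (`bernoulliExp_discreteDeriv_gap`). Each pair (k, j) not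
yet treated contributes at least (c/n)(1 - 2c/n)^(3n), by the event that rows i, k and column j are
empty.

Treating the rows of one half first leaves about n/2 such k for about n²/2 pairs. After division by
n, the total gain is asymptotically at least c² e^(-6c)/16, which exceeds the stated bound. -/

namespace Flexibility

/-! ### Product Bernoulli expectations and discrete derivatives -/

section Bernoulli

variable {ι : Type} [Fintype ι]

/-- The probability of `x` under the product Bernoulli law with parameters `p`. -/
noncomputable def bernoulliWeight (p : ι → ℝ) (x : ι → Bool) : ℝ :=
  ∏ i, if x i then p i else 1 - p i

theorem bernoulliWeight_nonneg {p : ι → ℝ} (hp : ∀ i, p i ∈ Set.Icc (0 : ℝ) 1) (x : ι → Bool) :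
    0 ≤ bernoulliWeight p x := by
  refine Finset.prod_nonneg fun i _ => ?_
  split_ifs
  · exact (hp i).1
  · exact sub_nonneg.2 (hp i).2

variable [DecidableEq ι]

/-- The expectation of `f` under the product Bernoulli law with parameters `p`. -/
noncomputable def bernoulliExp (p : ι → ℝ) (f : (ι → Bool) → ℝ) : ℝ :=
  ∑ x, bernoulliWeight p x * f x

/-- The discrete derivative of `f` in the coordinate `e`. -/
def discreteDeriv (e : ι) (f : (ι → Bool) → ℝ) (x : ι → Bool) : ℝ :=
  f (Function.update x e true) - f (Function.update x e false)

theorem bernoulliExp_mono {p : ι → ℝ} (hp : ∀ i, p i ∈ Set.Icc (0 : ℝ) 1)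
    {f g : (ι → Bool) → ℝ} (h : ∀ x, f x ≤ g x) : bernoulliExp p f ≤ bernoulliExp p g :=
  Finset.sum_le_sum fun x _ => mul_le_mul_of_nonneg_left (h x) (bernoulliWeight_nonneg hp x)

theorem bernoulliExp_sub (p : ι → ℝ) (f g : (ι → Bool) → ℝ) :
    bernoulliExp p (fun x => f x - g x) = bernoulliExp p f - bernoulliExp p g := by
  simp only [bernoulliExp, mul_sub, Finset.sum_sub_distrib]

theorem bernoulliExp_add (p : ι → ℝ) (f g : (ι → Bool) → ℝ) :
    bernoulliExp p (fun x => f x + g x) = bernoulliExp p f + bernoulliExp p g := by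
  simp only [bernoulliExp, mul_add, Finset.sum_add_distrib]

theorem bernoulliExp_const_mul (p : ι → ℝ) (a : ℝ) (f : (ι → Bool) → ℝ) :
    bernoulliExp p (fun x => a * f x) = a * bernoulliExp p f := by
  simp only [bernoulliExp, Finset.mul_sum]
  exact Finset.sum_congr rfl fun x _ => by ring

/-- The expectation of a product of functions of the single coordinates. -/
theorem bernoulliExp_prod (p : ι → ℝ) (g : ι → Bool → ℝ) :
    bernoulliExp p (fun x => ∏ i, g i (x i)) =
      ∏ i, (p i * g i true + (1 - p i) * g i false) := by
  have h := Fintype.prod_sum (fun (i : ι) (b : Bool) => (if b then p i else 1 - p i) * g i b)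
  simp only [Fintype.sum_bool, if_true, Bool.false_eq_true, if_false] at h
  rw [h]
  simp only [bernoulliExp, bernoulliWeight, ← Finset.prod_mul_distrib]

theorem bernoulliExp_const (p : ι → ℝ) (a : ℝ) : bernoulliExp p (fun _ => a) = a := by
  have h := bernoulliExp_prod p (fun _ _ => 1)
  simp only [Finset.prod_const_one, mul_one, add_sub_cancel] at h
  have h2 := bernoulliExp_const_mul p a (fun _ => 1)
  rw [h] at h2
  simpa using h2

/-- The probability that all coordinates in `Z` are `false`. -/
theorem bernoulliExp_forall_false (p : ι → ℝ) (Z : Finset ι) :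
    bernoulliExp p (fun x => if ∀ z ∈ Z, x z = false then 1 else 0) = ∏ z ∈ Z, (1 - p z) := by
  have h := bernoulliExp_prod p (fun i b => if i ∈ Z then (if b then 0 else 1) else 1)
  have h2 : (fun x : ι → Bool => ∏ i, (if i ∈ Z then (if x i then (0 : ℝ) else 1) else 1)) =
      fun x => if ∀ z ∈ Z, x z = false then 1 else 0 := by
    funext x
    split_ifs with hx
    · refine Finset.prod_eq_one fun i _ => ?_
      split_ifs with h1 h2
      · simp [hx i h1] at h2
      · rfl
      · rfl
    · push Not at hx
      obtain ⟨z, hz, hxz⟩ := hx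
      refine Finset.prod_eq_zero (Finset.mem_univ z) ?_
      simp at hxz
      simp [hz, hxz]
  rw [h2] at h
  rw [h, ← Finset.prod_subset (Finset.subset_univ Z)]
  · exact Finset.prod_congr rfl fun i hi => by simp [hi]
  · intro i _ hi
    simp [hi]

/-- Conditioning on coordinate e: what remains does not involve the parameter at e, so the
expectation is affine in that parameter. -/
theorem bernoulliExp_update (p : ι → ℝ) (e : ι) (a : ℝ) (f : (ι → Bool) → ℝ) :
    bernoulliExp (Function.update p e a) f =
      a * bernoulliExp p (fun x => f (Function.update x e true)) +
        (1 - a) * bernoulliExp p (fun x => f (Function.update x e false)) := by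
  -- Fubini: sum over coordinate e separately from the remaining coordinates y.
  have key : ∀ (q : ι → ℝ) (g : (ι → Bool) → ℝ), bernoulliExp q g =
      ∑ y : {j // j ≠ e} → Bool, (∏ j, if y j then q j else 1 - q j) *
        (q e * g ((Equiv.funSplitAt e Bool).symm (true, y)) +
          (1 - q e) * g ((Equiv.funSplitAt e Bool).symm (false, y))) := by
    intro q g
    have hw : ∀ (b : Bool) (y : {j // j ≠ e} → Bool),
        bernoulliWeight q ((Equiv.funSplitAt e Bool).symm (b, y)) =
          (if b then q e else 1 - q e) * ∏ j, if y j then q j else 1 - q j := by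
      intro b y
      rw [bernoulliWeight, ← Fintype.prod_equiv (Equiv.optionSubtypeNe e) _ _ (fun _ => rfl),
        Fintype.prod_option]
      congr 1
      · simp [Equiv.funSplitAt, Equiv.piSplitAt]
      · refine Finset.prod_congr rfl fun j _ => ?_
        simp [Equiv.funSplitAt, Equiv.piSplitAt, j.2]
    rw [bernoulliExp, ← Equiv.sum_comp (Equiv.funSplitAt e Bool).symm, Fintype.sum_prod_type,
      Fintype.sum_bool, ← Finset.sum_add_distrib]
    refine Finset.sum_congr rfl fun y _ => ?_
    rw [hw, hw]
    simp only [if_true, Bool.false_eq_true, if_false]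
    ring
  have hu : ∀ (b b' : Bool) (y : {j // j ≠ e} → Bool),
      Function.update ((Equiv.funSplitAt e Bool).symm (b, y)) e b' =
        (Equiv.funSplitAt e Bool).symm (b', y) := by
    intro b b' y
    funext j
    by_cases hj : j = e
    · subst hj; simp [Equiv.funSplitAt, Equiv.piSplitAt]
    · simp [Equiv.funSplitAt, Equiv.piSplitAt, hj]
  rw [key, key, key, Finset.mul_sum, Finset.mul_sum, ← Finset.sum_add_distrib]
  refine Finset.sum_congr rfl fun y _ => ?_
  have hq : (∏ j : {j // j ≠ e}, if y j then Function.update p e a j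
      else 1 - Function.update p e a j) = ∏ j : {j // j ≠ e}, if y j then p j else 1 - p j :=
    Finset.prod_congr rfl fun j _ => by simp [j.2]
  simp only [hq, hu, Function.update_self]
  ring

theorem bernoulliExp_eq_split (p : ι → ℝ) (e : ι) (f : (ι → Bool) → ℝ) :
    bernoulliExp p f = p e * bernoulliExp p (fun x => f (Function.update x e true)) +
        (1 - p e) * bernoulliExp p (fun x => f (Function.update x e false)) := by
  rw [← bernoulliExp_update, Function.update_eq_self]

theorem bernoulliExp_update_sub (p : ι → ℝ) (e : ι) (a : ℝ) (f : (ι → Bool) → ℝ) :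
    bernoulliExp (Function.update p e a) f - bernoulliExp p f =
      (a - p e) * bernoulliExp p (discreteDeriv e f) := by
  rw [bernoulliExp_update, bernoulliExp_eq_split p e f]
  unfold discreteDeriv
  rw [bernoulliExp_sub]
  ring

/-- Changing the parameters of a product Bernoulli law one coordinate at a time. -/
theorem bernoulliExp_le_sub_sum (p p' : ι → ℝ) (f : (ι → Bool) → ℝ) (d : ι → ℝ)
    (h : ∀ e, ∀ q : ι → ℝ, (∀ i, q i = p i ∨ q i = p' i) →
      (p' e - p e) * bernoulliExp q (discreteDeriv e f) ≤ -d e) :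
    bernoulliExp p' f ≤ bernoulliExp p f - ∑ e, d e := by
  have key : ∀ U : Finset ι,
      bernoulliExp (fun i => if i ∈ U then p' i else p i) f ≤
        bernoulliExp p f - ∑ e ∈ U, d e := by
    intro U
    induction U using Finset.induction_on with
    | empty => simp
    | insert e U he ih =>
      have hq : (fun i => if i ∈ insert e U then p' i else p i) =
          Function.update (fun i => if i ∈ U then p' i else p i) e (p' e) := by
        funext i
        by_cases hi : i = e
        · subst hi; simp
        · simp [hi]
      have h1 := bernoulliExp_update_sub (fun i => if i ∈ U then p' i else p i) e (p' e) f
      have h2 := h e (fun i => if i ∈ U then p' i else p i)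
        (fun i => by by_cases hi : i ∈ U <;> simp [hi])
      rw [hq, Finset.sum_insert he]
      simp only [he, if_false] at h1
      linarith
  simpa using key Finset.univ

end Bernoulli

/-! ### Maximum matchings and substitutability of edges sharing a node -/

section Matching

variable {n : ℕ}

theorem IsMatching.card_le_maxMatching {R : Fin n × Fin n → Bool} {M : Finset (Fin n × Fin n)}
    (h : IsMatching R M) : M.card ≤ maxMatching R := by
  classical
  exact Finset.le_sup (f := Finset.card) (by simpa using h)

theorem exists_isMatching_card_eq (R : Fin n × Fin n → Bool) :
    ∃ M, IsMatching R M ∧ M.card = maxMatching R := by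
  classical
  obtain ⟨M, hM, h⟩ := Finset.exists_mem_eq_sup (Finset.univ.filter (IsMatching R))
    ⟨∅, by simp [IsMatching]⟩ Finset.card
  exact ⟨M, by simpa using hM, h.symm⟩

theorem maxMatching_le (R : Fin n × Fin n → Bool) : maxMatching R ≤ n := by
  obtain ⟨M, hM, h⟩ := exists_isMatching_card_eq R
  rw [← h]
  have := Finset.card_le_card_of_injOn (s := M) (t := Finset.univ) Prod.fst (by simp)
    (fun a ha b hb hab => by
      by_contra hne
      exact (hM.2 a ha b hb hne).1 hab)
  simpa using this

theorem maxMatching_mono {R R' : Fin n × Fin n → Bool} (h : ∀ e, R e = true → R' e = true) :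
    maxMatching R ≤ maxMatching R' := by
  obtain ⟨M, hM, hc⟩ := exists_isMatching_card_eq R
  rw [← hc]
  exact IsMatching.card_le_maxMatching ⟨fun e he => h e (hM.1 e he), hM.2⟩

/-- A matching uses at most one of two edges that share a node. -/
theorem maxMatching_update_update_le {R : Fin n × Fin n → Bool} {e e' : Fin n × Fin n}
    (hne : e ≠ e') (h : e.1 = e'.1 ∨ e.2 = e'.2) :
    maxMatching (Function.update (Function.update R e' true) e true) ≤
      max (maxMatching (Function.update (Function.update R e' false) e true))
        (maxMatching (Function.update (Function.update R e' true) e false)) := by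
  obtain ⟨M, hM, hc⟩ :=
    exists_isMatching_card_eq (Function.update (Function.update R e' true) e true)
  rw [← hc]
  by_cases he : e ∈ M
  · have he' : e' ∉ M := fun he' => by
      have := hM.2 e he e' he' hne
      tauto
    refine le_max_of_le_left (IsMatching.card_le_maxMatching ⟨fun a ha => ?_, hM.2⟩)
    have h1 := hM.1 a ha
    have h2 : a ≠ e' := fun h => he' (h ▸ ha)
    by_cases h3 : a = e
    · simp [h3]
    · simpa [h2, h3] using h1
  · refine le_max_of_le_right (IsMatching.card_le_maxMatching ⟨fun a ha => ?_, hM.2⟩)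
    have h1 := hM.1 a ha
    have h2 : a ≠ e := fun h => he (h ▸ ha)
    simpa [h2] using h1

/-- An edge between two isolated nodes increases the maximum matching. -/
theorem maxMatching_add_one_le_update {R : Fin n × Fin n → Bool} {e : Fin n × Fin n}
    (hr : ∀ k, R (e.1, k) = false) (hc : ∀ k, R (k, e.2) = false) :
    maxMatching R + 1 ≤ maxMatching (Function.update R e true) := by
  classical
  obtain ⟨M, hM, hcard⟩ := exists_isMatching_card_eq R
  have h1 : ∀ a ∈ M, a.1 ≠ e.1 := fun a ha h => by
    have := hM.1 a ha
    rw [show a = (e.1, a.2) from Prod.ext h rfl, hr] at this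
    simp at this
  have h2 : ∀ a ∈ M, a.2 ≠ e.2 := fun a ha h => by
    have := hM.1 a ha
    rw [show a = (a.1, e.2) from Prod.ext rfl h, hc] at this
    simp at this
  have he : e ∉ M := fun h => h1 e h rfl
  rw [← hcard, ← Finset.card_insert_of_notMem he]
  refine IsMatching.card_le_maxMatching ⟨fun a ha => ?_, fun a ha b hb hab => ?_⟩
  · by_cases h3 : a = e
    · simp [h3]
    · simpa [h3] using hM.1 a (Finset.mem_of_mem_insert_of_ne ha h3)
  · rcases Finset.mem_insert.1 ha with ha' | ha' <;>
      rcases Finset.mem_insert.1 hb with hb' | hb'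
    · exact absurd (ha'.trans hb'.symm) hab
    · exact ha' ▸ ⟨(h1 b hb').symm, (h2 b hb').symm⟩
    · exact hb' ▸ ⟨h1 a ha', h2 a ha'⟩
    · exact hM.2 a ha' b hb' hab

/-- The maximum matching size as a real function of the graph. -/
noncomputable def matchingSize (R : Fin n × Fin n → Bool) : ℝ := maxMatching R

theorem discreteDeriv_self_matchingSize (e : Fin n × Fin n) (R : Fin n × Fin n → Bool) :
    discreteDeriv e (discreteDeriv e matchingSize) R = 0 := by
  simp [discreteDeriv]

/-- With both edges present, the matching size is at most the larger of the two one-edge sizes; with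
neither, it is at most the smaller by monotonicity. Adding the two gives submodularity. -/
theorem discreteDeriv_discreteDeriv_matchingSize_nonpos {e e' : Fin n × Fin n}
    (h : e.1 = e'.1 ∨ e.2 = e'.2) (R : Fin n × Fin n → Bool) :
    discreteDeriv e' (discreteDeriv e matchingSize) R ≤ 0 := by
  by_cases hne : e = e'
  · rw [hne, discreteDeriv_self_matchingSize]
  have h1 := maxMatching_update_update_le (R := R) hne h
  have h2 : maxMatching (Function.update (Function.update R e' false) e false) ≤
      maxMatching (Function.update (Function.update R e' false) e true) :=
    maxMatching_mono fun a ha => by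
      by_cases h3 : a = e
      · simp [h3]
      · simpa [h3] using ha
  have h3 : maxMatching (Function.update (Function.update R e' false) e false) ≤
      maxMatching (Function.update (Function.update R e' true) e false) :=
    maxMatching_mono fun a ha => by
      by_cases h3 : a = e
      · simp [h3] at ha
      · by_cases h4 : a = e'
        · simp [h4, Ne.symm hne] at ha
        · simpa [h3, h4] using ha
  simp only [discreteDeriv, matchingSize]
  have h4 : maxMatching (Function.update (Function.update R e' true) e true) +
      maxMatching (Function.update (Function.update R e' false) e false) ≤
      maxMatching (Function.update (Function.update R e' false) e true) +
      maxMatching (Function.update (Function.update R e' true) e false) := by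
    omega
  have h5 := (Nat.cast_le (α := ℝ)).2 h4
  push_cast at h5
  linarith

/-- The pairs that involve the left node `i`, the left node `k` or the right node `j`. -/
def emptyLines (i k j : Fin n) : Finset (Fin n × Fin n) :=
  Finset.univ.filter fun a => a.1 = i ∨ a.1 = k ∨ a.2 = j

theorem card_emptyLines_le (i k j : Fin n) : (emptyLines i k j).card ≤ 3 * n := by
  classical
  have h : emptyLines i k j ⊆ (Finset.univ.image fun a => (i, a)) ∪
      ((Finset.univ.image fun a => (k, a)) ∪ (Finset.univ.image fun a => (a, j))) := by
    rintro ⟨a, b⟩ h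
    simp only [emptyLines, Finset.mem_filter, Finset.mem_univ, true_and] at h
    simp only [Finset.mem_union, Finset.mem_image, Finset.mem_univ, true_and, Prod.mk.injEq]
    rcases h with h | h | h
    · exact Or.inl ⟨b, h.symm, rfl⟩
    · exact Or.inr (Or.inl ⟨b, h.symm, rfl⟩)
    · exact Or.inr (Or.inr ⟨a, rfl, h.symm⟩)
  have h1 := Finset.card_image_le (s := (Finset.univ : Finset (Fin n))) (f := fun a => (i, a))
  have h2 := Finset.card_image_le (s := (Finset.univ : Finset (Fin n))) (f := fun a => (k, a))
  have h3 := Finset.card_image_le (s := (Finset.univ : Finset (Fin n))) (f := fun a => (a, j))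
  have h4 := (Finset.card_le_card h).trans (Finset.card_union_le _ _)
  have h5 := Finset.card_union_le (Finset.univ.image fun a : Fin n => (k, a))
    (Finset.univ.image fun a => (a, j))
  simp only [Finset.card_univ, Fintype.card_fin] at h1 h2 h3
  omega

/-- When these lines are empty, either edge alone gains one, yet both together do no better than one
of them, since they compete for j. -/
theorem discreteDeriv_discreteDeriv_matchingSize_le_neg_one {i k j : Fin n} (hik : i ≠ k)
    {R : Fin n × Fin n → Bool} (hR : ∀ z ∈ emptyLines i k j, R z = false) :
    discreteDeriv (k, j) (discreteDeriv (i, j) matchingSize) R ≤ -1 := by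
  have hne : ((i, j) : Fin n × Fin n) ≠ (k, j) := by simp [hik]
  have h1 := maxMatching_update_update_le (R := R) hne (Or.inr rfl)
  have e1 : Function.update R (k, j) false = R := by
    rw [← hR (k, j) (by simp [emptyLines]), Function.update_eq_self]
  have e2 : Function.update R (i, j) false = R := by
    rw [← hR (i, j) (by simp [emptyLines]), Function.update_eq_self]
  have e3 : Function.update (Function.update R (k, j) true) (i, j) false =
      Function.update R (k, j) true := by
    rw [Function.update_comm hne.symm, e2]
  have h2 := maxMatching_add_one_le_update (R := R) (e := (i, j))
    (fun a => hR _ (by simp [emptyLines])) (fun a => hR _ (by simp [emptyLines]))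
  have h3 := maxMatching_add_one_le_update (R := R) (e := (k, j))
    (fun a => hR _ (by simp [emptyLines])) (fun a => hR _ (by simp [emptyLines]))
  simp only [discreteDeriv, matchingSize]
  rw [e3, e1] at h1
  rw [e3, e1, e2]
  have h4 : maxMatching (Function.update (Function.update R (k, j) true) (i, j) true) +
      maxMatching R + 1 ≤
      maxMatching (Function.update R (i, j) true) +
      maxMatching (Function.update R (k, j) true) := by
    omega
  have h5 := (Nat.cast_le (α := ℝ)).2 h4
  push_cast at h5
  linarith

end Matching

/-! ### Interpolation from the balanced to the uniform graph -/

section Interpolation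

variable {n : ℕ}

/-- The edge probabilities of the graph in which the pairs in `S` have probability `c / n` and the
other pairs have the probability prescribed by the flexibility indicators `F` and `G`. -/
noncomputable def hybridProb (c : ℝ) (S : Finset (Fin n × Fin n)) (F G : Fin n → Bool)
    (a : Fin n × Fin n) : ℝ :=
  if a ∈ S then c / n
  else ((if F a.1 then 1 else 0) + (if G a.2 then 1 else 0)) * (c / n)

/-- The expected size of a maximum matching in the graph with edge probabilities `hybridProb`,
each node being flexible with probability `1 / 2`. -/
noncomputable def hybridMatching (c : ℝ) (S : Finset (Fin n × Fin n)) : ℝ :=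
  bernoulliExp (fun _ : Fin n => (1 / 2 : ℝ)) fun F =>
    bernoulliExp (fun _ : Fin n => (1 / 2 : ℝ)) fun G =>
      bernoulliExp (hybridProb c S F G) matchingSize

theorem hybridProb_mem_Icc {c : ℝ} (hc : 0 ≤ c) (S : Finset (Fin n × Fin n))
    (F G : Fin n → Bool) (a : Fin n × Fin n) :
    hybridProb c S F G a ∈ Set.Icc 0 (2 * (c / n)) := by
  have h : 0 ≤ c / n := by positivity
  unfold hybridProb
  split_ifs <;> constructor <;> linarith

theorem two_mul_div_le_one {c : ℝ} (hn : 2 * c ≤ n) :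
    2 * (c / n) ≤ 1 := by
  rw [← mul_div_assoc]
  exact div_le_one_of_le₀ hn (Nat.cast_nonneg n)

/-- Making both end nodes of a pair flexible lowers the expected gain of adding that pair. -/
theorem bernoulliExp_discreteDeriv_gap {c : ℝ} (hc : 0 ≤ c) (hn : 2 * c ≤ n)
    (S : Finset (Fin n × Fin n)) (F G : Fin n → Bool) (i j : Fin n) (K : Finset (Fin n))
    (hK : ∀ k ∈ K, k ≠ i ∧ (k, j) ∉ S) :
    K.card * ((c / n) * (1 - 2 * (c / n)) ^ (3 * n)) ≤
      bernoulliExp (hybridProb c S (Function.update F i false) (Function.update G j false))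
          (discreteDeriv (i, j) matchingSize) -
        bernoulliExp (hybridProb c S (Function.update F i true) (Function.update G j true))
          (discreteDeriv (i, j) matchingSize) := by
  have h0 : 0 ≤ c / n := by positivity
  have h1 : 2 * (c / n) ≤ 1 := two_mul_div_le_one hn
  set δ := (c / n) * (1 - 2 * (c / n)) ^ (3 * n) with hδ
  -- The loss is charged only to the pairs (k, j) with k in K; every other pair need only contribute
  -- with the right sign.
  have hsum : ∑ e : Fin n × Fin n, (if e.1 ∈ K ∧ e.2 = j then δ else 0) = K.card * δ := by
    rw [Fintype.sum_prod_type]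
    simp only [ite_and]
    rw [Finset.sum_congr rfl fun x _ => show _ = if x ∈ K then δ else 0 by split_ifs <;> simp]
    simp [Finset.sum_ite_mem]
  rw [← hsum, le_sub_comm]
  refine bernoulliExp_le_sub_sum _ _ _ _ ?_
  rintro ⟨a, b⟩ q hq
  have hq1 : ∀ z, q z ∈ Set.Icc 0 (2 * (c / n)) := fun z => by
    rcases hq z with h | h <;> rw [h] <;> exact hybridProb_mem_Icc hc _ _ _ _
  have hq2 : ∀ z, q z ∈ Set.Icc (0 : ℝ) 1 := fun z => ⟨(hq1 z).1, (hq1 z).2.trans h1⟩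
  by_cases hab : a = i ∨ b = j
  · have hmono : 0 ≤
        hybridProb c S (Function.update F i true) (Function.update G j true) (a, b) -
        hybridProb c S (Function.update F i false) (Function.update G j false) (a, b) := by
      unfold hybridProb
      by_cases ha : a = i <;> by_cases hb : b = j <;> simp [ha, hb] <;> split_ifs <;> linarith
    have hnonpos : bernoulliExp q (discreteDeriv (a, b) (discreteDeriv (i, j) matchingSize)) ≤ 0 := by
      have := bernoulliExp_mono hq2 (g := fun _ => 0) fun x =>
        discreteDeriv_discreteDeriv_matchingSize_nonpos (e := (i, j)) (e' := (a, b))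
          (hab.imp Eq.symm Eq.symm) x
      rwa [bernoulliExp_const] at this
    by_cases hk : a ∈ K ∧ b = j
    · obtain ⟨hk, rfl⟩ := hk
      obtain ⟨hai, haS⟩ := hK a hk
      have hdiff : hybridProb c S (Function.update F i true) (Function.update G b true) (a, b) -
          hybridProb c S (Function.update F i false) (Function.update G b false) (a, b) =
            c / n := by
        simp only [hybridProb, haS, Function.update_of_ne hai]
        simp [add_mul]
      have hstrict : bernoulliExp q (discreteDeriv (a, b) (discreteDeriv (i, b) matchingSize)) ≤
          -(1 - 2 * (c / n)) ^ (3 * n) := by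
        have h2 := bernoulliExp_mono hq2
          (f := discreteDeriv (a, b) (discreteDeriv (i, b) matchingSize))
          (g := fun x => (-1) * (if ∀ z ∈ emptyLines i a b, x z = false then 1 else 0))
          fun x => by
            split_ifs with hx
            · simpa using discreteDeriv_discreteDeriv_matchingSize_le_neg_one (Ne.symm hai) hx
            · simpa using discreteDeriv_discreteDeriv_matchingSize_nonpos
                (e := (i, b)) (e' := (a, b)) (Or.inr rfl) x
        rw [bernoulliExp_const_mul, bernoulliExp_forall_false] at h2
        -- At most 3n pairs must be absent, each of probability at most 2c/n under any intermediate
        -- law.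
        have h3 : (1 - 2 * (c / n)) ^ (3 * n) ≤ ∏ z ∈ emptyLines i a b, (1 - q z) := by
          refine (pow_le_pow_of_le_one (sub_nonneg.2 h1) (by linarith)
            (card_emptyLines_le i a b)).trans ?_
          rw [← Finset.prod_const]
          exact Finset.prod_le_prod (fun _ _ => sub_nonneg.2 h1)
            fun z _ => sub_le_sub_left (hq1 z).2 _
        linarith
      rw [hdiff]
      simp only [hk, and_self, if_true]
      rw [hδ, ← mul_neg]
      exact mul_le_mul_of_nonneg_left hstrict h0
    · simp only [hk, if_false, neg_zero]
      exact mul_nonpos_of_nonneg_of_nonpos hmono hnonpos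
  -- Off row i and column j the two laws agree.
  · push Not at hab
    simp [hybridProb, hab.1, hab.2]

theorem hybridProb_insert (c : ℝ) (S : Finset (Fin n × Fin n)) (e : Fin n × Fin n)
    (F G : Fin n → Bool) :
    hybridProb c (insert e S) F G = Function.update (hybridProb c S F G) e (c / n) := by
  funext a
  by_cases ha : a = e
  · subst ha; simp [hybridProb]
  · simp [hybridProb, ha]

theorem bernoulliExp_half_eq_split {ι : Type} [Fintype ι] [DecidableEq ι] (i : ι)
    (f : (ι → Bool) → ℝ) :
    bernoulliExp (fun _ => (1 / 2 : ℝ)) f = bernoulliExp (fun _ => (1 / 2 : ℝ)) (fun x =>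
      1 / 2 * (f (Function.update x i true) + f (Function.update x i false))) := by
  rw [bernoulliExp_eq_split _ i, bernoulliExp_const_mul, bernoulliExp_add]
  ring

/-- Averaging over the four values of (F i, G j), the factor 1 - F i - G j is 1, 0, 0, -1, each with
weight 1/4. This produces c/(4n) times the difference in the hypothesis. -/
theorem hybridMatching_insert {c : ℝ} {S : Finset (Fin n × Fin n)} {i j : Fin n}
    (he : (i, j) ∉ S) {δ : ℝ} (hc : 0 ≤ c)
    (h : ∀ F G : Fin n → Bool, δ ≤
      bernoulliExp (hybridProb c S (Function.update F i false) (Function.update G j false))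
          (discreteDeriv (i, j) matchingSize) -
        bernoulliExp (hybridProb c S (Function.update F i true) (Function.update G j true))
          (discreteDeriv (i, j) matchingSize)) :
    hybridMatching c S + c / n / 4 * δ ≤ hybridMatching c (insert (i, j) S) := by
  have h0 : 0 ≤ c / n := by positivity
  have hhalf : ∀ _ : Fin n, (1 / 2 : ℝ) ∈ Set.Icc (0 : ℝ) 1 := fun _ => by norm_num
  suffices hs : c / n / 4 * δ ≤ hybridMatching c (insert (i, j) S) - hybridMatching c S by
    linarith
  have h1 : hybridMatching c (insert (i, j) S) - hybridMatching c S =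
      bernoulliExp (fun _ : Fin n => (1 / 2 : ℝ)) fun F =>
        bernoulliExp (fun _ : Fin n => (1 / 2 : ℝ)) fun G =>
          (c / n - ((if F i then 1 else 0) + (if G j then 1 else 0)) * (c / n)) *
            bernoulliExp (hybridProb c S F G) (discreteDeriv (i, j) matchingSize) := by
    unfold hybridMatching
    rw [← bernoulliExp_sub]
    congr 1
    funext F
    rw [← bernoulliExp_sub]
    congr 1
    funext G
    rw [hybridProb_insert, bernoulliExp_update_sub]
    simp [hybridProb, he]
  rw [h1, ← bernoulliExp_const (fun _ : Fin n => (1 / 2 : ℝ)) (c / n / 4 * δ)]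
  refine le_of_le_of_eq (bernoulliExp_mono hhalf fun F => ?_)
    (bernoulliExp_half_eq_split i _).symm
  rw [← bernoulliExp_add, ← bernoulliExp_const_mul,
    ← bernoulliExp_const (fun _ : Fin n => (1 / 2 : ℝ)) (c / n / 4 * δ)]
  refine le_of_le_of_eq ?_ (bernoulliExp_half_eq_split j _).symm
  refine bernoulliExp_mono hhalf fun G => ?_
  simp only [Function.update_self, if_true, Bool.false_eq_true, if_false]
  have := mul_le_mul_of_nonneg_left (h F G) (by positivity : 0 ≤ c / n / 4)
  linarith

/-- The qualitative gap, with K empty, already makes every increment nonnegative. -/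
theorem hybridMatching_mono {c : ℝ} (hc : 0 ≤ c) (hn : 2 * c ≤ n)
    (S U : Finset (Fin n × Fin n)) : hybridMatching c S ≤ hybridMatching c (S ∪ U) := by
  induction U using Finset.induction_on with
  | empty => simp
  | insert e U he ih =>
    rw [Finset.union_insert]
    by_cases hS : e ∈ S ∪ U
    · rwa [Finset.insert_eq_of_mem hS]
    · have := hybridMatching_insert (i := e.1) (j := e.2) hS (δ := 0) hc fun F G => by
        simpa using bernoulliExp_discreteDeriv_gap hc hn (S ∪ U) F G e.1 e.2 ∅ (by simp)
      simp only [mul_zero, add_zero] at this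
      exact ih.trans this

/-- The uniform graph has a larger expected maximum matching than the graph in which each node is
flexible with probability `1 / 2`. -/
theorem hybridMatching_gap {c : ℝ} (hc : 0 ≤ c) (hn : 2 * c ≤ n) :
    hybridMatching c (∅ : Finset (Fin n × Fin n)) +
      ((n / 2 : ℕ) * n : ℝ) * (c / n / 4 * (((n - n / 2 : ℕ) : ℝ) *
        ((c / n) * (1 - 2 * (c / n)) ^ (3 * n)))) ≤
      hybridMatching c (Finset.univ : Finset (Fin n × Fin n)) := by
  -- While only rows in T are being treated, all rows in K are untouched and serve as the
  -- competitors k for every pair.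
  set K : Finset (Fin n) := Finset.univ.filter fun k => ¬ (k : ℕ) < n / 2 with hKdef
  set T : Finset (Fin n) := Finset.univ.filter fun k => (k : ℕ) < n / 2 with hTdef
  have hT : T.card = n / 2 := by
    rw [hTdef, Fin.card_filter_val_lt]
    omega
  have hK : K.card = n - n / 2 := by
    have hKT : K = Tᶜ := by
      ext k
      simp [hKdef, hTdef]
    rw [hKT, Finset.card_compl, hT, Fintype.card_fin]
  have key : ∀ U : Finset (Fin n × Fin n), U ⊆ T ×ˢ Finset.univ →
      hybridMatching c (∅ : Finset (Fin n × Fin n)) +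
        U.card * (c / n / 4 * (((n - n / 2 : ℕ) : ℝ) *
          ((c / n) * (1 - 2 * (c / n)) ^ (3 * n)))) ≤ hybridMatching c U := by
    intro U
    induction U using Finset.induction_on with
    | empty => simp
    | insert e U he ih =>
      intro hU
      have h1 := ih ((Finset.subset_insert e U).trans hU)
      have he1 : e.1 ∈ T := (Finset.mem_product.1 (hU (Finset.mem_insert_self e U))).1
      have h2 := hybridMatching_insert (i := e.1) (j := e.2) he hc fun F G =>
        bernoulliExp_discreteDeriv_gap hc hn U F G e.1 e.2 K fun k hk => by
          have hkT : k ∉ T := by simpa [hKdef, hTdef] using hk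
          exact ⟨fun h => hkT (h ▸ he1), fun h => hkT
            (Finset.mem_product.1 (hU (Finset.mem_insert_of_mem h))).1⟩
      rw [hK] at h2
      rw [Finset.card_insert_of_notMem he]
      push_cast [-Nat.cast_sub] at h1 h2 ⊢
      linarith
  have h := key _ subset_rfl
  rw [Finset.card_product, hT, Finset.card_univ, Fintype.card_fin, Nat.cast_mul] at h
  have h2 := hybridMatching_mono hc hn (T ×ˢ Finset.univ) Finset.univ
  rw [Finset.union_eq_right.2 (Finset.subset_univ _)] at h2
  exact h.trans h2

end Interpolation

/-! ### Identification with the graph law and passage to the limit -/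

section Law

theorem indepBernoulli_toReal {ι : Type} [Fintype ι] [DecidableEq ι] (p : ι → unitInterval)
    (x : ι → Bool) : (indepBernoulli p x).toReal = bernoulliWeight (fun i => (p i : ℝ)) x := by
  rw [indepBernoulli, PMF.ofFintype_apply, ENNReal.toReal_prod, bernoulliWeight]
  refine Finset.prod_congr rfl fun i _ => ENNReal.toReal_ofReal ?_
  split_ifs
  · exact (p i).2.1
  · exact sub_nonneg.2 (p i).2.2

theorem toReal_bind_apply {A B : Type} [Fintype A] (p : PMF A) (f : A → PMF B) (b : B) :
    (p.bind f b).toReal = ∑ a, (p a).toReal * (f a b).toReal := by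
  rw [PMF.bind_apply, tsum_fintype, ENNReal.toReal_sum]
  · exact Finset.sum_congr rfl fun a _ => ENNReal.toReal_mul
  · exact fun a _ => ENNReal.mul_ne_top (p.apply_ne_top a) ((f a).apply_ne_top b)

theorem muN_eq (αf α bl br : ℝ) (n : ℕ) :
    muN αf α bl br n =
      (bernoulliExp (fun _ : Fin n => (toProb bl : ℝ)) fun F =>
        bernoulliExp (fun _ : Fin n => (toProb br : ℝ)) fun G =>
          bernoulliExp (fun e : Fin n × Fin n => (edgeProb αf α n (F e.1) (G e.2) : ℝ))
            matchingSize) / n := by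
  simp only [muN, graphLaw, toReal_bind_apply, indepBernoulli_toReal, bernoulliExp, matchingSize,
    Finset.mul_sum, Finset.sum_mul, Finset.sum_div]
  rw [Finset.sum_comm]
  refine Finset.sum_congr rfl fun F _ => ?_
  rw [Finset.sum_comm]
  refine Finset.sum_congr rfl fun G _ => Finset.sum_congr rfl fun R _ => ?_
  ring

theorem muN_mem_Icc (αf α bl br : ℝ) (n : ℕ) : muN αf α bl br n ∈ Set.Icc (0 : ℝ) 1 := by
  have hp : ∀ {ι : Type} (p : ι → unitInterval) (i : ι), (p i : ℝ) ∈ Set.Icc (0 : ℝ) 1 :=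
    fun p i => (p i).2
  rw [muN_eq]
  constructor
  · refine div_nonneg ?_ (Nat.cast_nonneg n)
    rw [← bernoulliExp_const (fun _ : Fin n => (toProb bl : ℝ)) 0]
    refine bernoulliExp_mono (hp _) fun F => ?_
    rw [← bernoulliExp_const (fun _ : Fin n => (toProb br : ℝ)) 0]
    refine bernoulliExp_mono (hp _) fun G => ?_
    rw [← bernoulliExp_const (fun e : Fin n × Fin n => (edgeProb αf α n (F e.1) (G e.2) : ℝ)) 0]
    exact bernoulliExp_mono (hp _) fun R => Nat.cast_nonneg _
  · refine div_le_one_of_le₀ ?_ (Nat.cast_nonneg n)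
    rw [← bernoulliExp_const (fun _ : Fin n => (toProb bl : ℝ)) n]
    refine bernoulliExp_mono (hp _) fun F => ?_
    rw [← bernoulliExp_const (fun _ : Fin n => (toProb br : ℝ)) n]
    refine bernoulliExp_mono (hp _) fun G => ?_
    rw [← bernoulliExp_const (fun e : Fin n × Fin n => (edgeProb αf α n (F e.1) (G e.2) : ℝ)) n]
    exact bernoulliExp_mono (hp _) fun R => Nat.cast_le.2 (maxMatching_le R)

theorem coe_toProb {x : ℝ} (hx : x ∈ Set.Icc (0 : ℝ) 1) : (toProb x : ℝ) = x := by
  rw [toProb, Set.projIcc_of_mem _ hx]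

theorem bernoulliExp_zero_one {ι : Type} [Fintype ι] [DecidableEq ι] (b : Bool)
    (f : (ι → Bool) → ℝ) :
    bernoulliExp (fun _ : ι => if b then 1 else 0) f = f fun _ => b := by
  rw [bernoulliExp, Finset.sum_eq_single fun _ => b]
  · cases b <;> simp [bernoulliWeight]
  · intro x _ hx
    obtain ⟨i, hi⟩ := Function.ne_iff.1 hx
    rw [bernoulliWeight, Finset.prod_eq_zero (Finset.mem_univ i), zero_mul]
    cases b <;> simp_all
  · simp

theorem muN_one_zero {c : ℝ} (hc : 0 ≤ c) {n : ℕ} (hn : 2 * c ≤ n) :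
    muN c 0 1 0 n = hybridMatching c (Finset.univ : Finset (Fin n × Fin n)) / n := by
  have h1 := two_mul_div_le_one hn
  have h0 : 0 ≤ c / n := by positivity
  have hu : ∀ F G : Fin n → Bool, hybridProb c Finset.univ F G = fun _ => c / n := fun F G => by
    funext a
    simp [hybridProb]
  have ht := fun f => bernoulliExp_zero_one (ι := Fin n) true f
  have hf := fun f => bernoulliExp_zero_one (ι := Fin n) false f
  simp only [if_true, Bool.false_eq_true, if_false] at ht hf
  rw [muN_eq, coe_toProb (by simp), coe_toProb (by simp), ht, hf, hybridMatching]
  simp only [hu, bernoulliExp_const]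
  congr 2
  funext e
  rw [edgeProb, coe_toProb] <;> simp
  exact ⟨h0, by linarith⟩

theorem muN_half_half {c : ℝ} (hc : 0 ≤ c) {n : ℕ} (hn : 2 * c ≤ n) :
    muN c 0 (1 / 2) (1 / 2) n = hybridMatching c (∅ : Finset (Fin n × Fin n)) / n := by
  have h1 := two_mul_div_le_one hn
  rw [muN_eq, coe_toProb (by norm_num), hybridMatching]
  congr 2
  funext F
  congr 1
  funext G
  congr 1
  funext e
  have h := hybridProb_mem_Icc hc (∅ : Finset (Fin n × Fin n)) F G e
  have he : hybridProb c ∅ F G e = 2 * (0 / n) +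
      ((if F e.1 then (1 : ℝ) else 0) + (if G e.2 then (1 : ℝ) else 0)) * (c / n - 0 / n) := by
    simp [hybridProb]
  rw [edgeProb, ← he, coe_toProb ⟨h.1, h.2.trans h1⟩]

/-- The sequence is a lower bound for the normalised gain: 1 - 1/n² accounts for the parity of n,
and the cube comes from the three empty lines. -/
theorem tendsto_gap (c : ℝ) :
    Tendsto (fun n : ℕ => c ^ 2 / 16 * (1 - (1 / n) ^ 2) * ((1 + -2 * c / n) ^ n) ^ 3) atTop
      (nhds (c ^ 2 / 16 * Real.exp (-6 * c))) := by
  have h1 := (Real.tendsto_one_add_div_pow_exp (-2 * c)).pow 3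
  have h2 := (tendsto_one_div_atTop_nhds_zero_nat (𝕜 := ℝ)).pow 2
  have h3 := ((h2.const_sub 1).const_mul (c ^ 2 / 16)).mul h1
  rw [← Real.exp_nat_mul] at h3
  convert h3 using 2
  rw [show ((3 : ℕ) : ℝ) * (-2 * c) = -6 * c by push_cast; ring]
  norm_num

theorem eventually_muN_gap {c : ℝ} (hc : 0 < c) : ∀ᶠ n : ℕ in atTop,
    muN c 0 (1 / 2) (1 / 2) n + c ^ 3 / 2 ^ 5 * Real.exp (-7 * c) ≤ muN c 0 1 0 n := by
  -- Follows from c < e^c; the strict inequality lets the bound hold for all large n and not only in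
  -- the limit.
  have hlt : c ^ 3 / 2 ^ 5 * Real.exp (-7 * c) < c ^ 2 / 16 * Real.exp (-6 * c) := by
    have h1 : Real.exp (-6 * c) = Real.exp (-7 * c) * Real.exp c := by
      rw [← Real.exp_add]; ring_nf
    have h2 : c < Real.exp c := by linarith [Real.add_one_le_exp c]
    have h3 : 0 < c ^ 2 * Real.exp (-7 * c) := by positivity
    rw [h1]
    have h4 := mul_lt_mul_of_pos_left h2 h3
    have h5 := mul_pos h3 (Real.exp_pos c)
    linarith
  filter_upwards [(tendsto_gap c).eventually (eventually_gt_nhds hlt),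
    eventually_ge_atTop (⌈2 * c⌉₊), eventually_gt_atTop 0] with n hgap hn hpos
  have hn : 2 * c ≤ n := Nat.ceil_le.1 hn
  have hn0 : (0 : ℝ) < n := Nat.cast_pos.2 hpos
  have h := hybridMatching_gap hc.le hn
  rw [muN_one_zero hc.le hn, muN_half_half hc.le hn]
  rw [← le_sub_iff_add_le', ← sub_div, le_div_iff₀ hn0]
  have hbase : (1 : ℝ) - 2 * (c / n) = 1 + -2 * c / n := by ring
  have hb0 : 0 ≤ 1 - 2 * (c / n) := sub_nonneg.2 (two_mul_div_le_one hn)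
  -- Equality holds for odd n, where the halves differ by one.
  have hprod : ((n : ℝ) ^ 2 - 1) / 4 ≤ (n / 2 : ℕ) * (n - n / 2 : ℕ) := by
    obtain ⟨m, rfl | rfl⟩ := n.even_or_odd'
    · rw [show 2 * m / 2 = m by omega, show 2 * m - m = m by omega]
      push_cast
      nlinarith
    · rw [show (2 * m + 1) / 2 = m by omega, show 2 * m + 1 - m = m + 1 by omega]
      push_cast
      nlinarith
  rw [hbase, pow_mul'] at h
  rw [hbase] at hb0
  set q := ((1 + -2 * c / (n : ℝ)) ^ n) ^ 3
  have hq : 0 ≤ q := by positivity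
  have hmain : c ^ 2 / 16 * (1 - (1 / n) ^ 2) * q * n ≤
      ((n / 2 : ℕ) * n : ℝ) * (c / n / 4 * (((n - n / 2 : ℕ) : ℝ) * ((c / n) * q))) := by
    have e1 : c ^ 2 / 16 * (1 - (1 / n) ^ 2) * q * n =
        c ^ 2 * q / (4 * n) * (((n : ℝ) ^ 2 - 1) / 4) := by
      field_simp
      ring
    have e2 : ((n / 2 : ℕ) * n : ℝ) * (c / n / 4 * (((n - n / 2 : ℕ) : ℝ) * ((c / n) * q))) =
        c ^ 2 * q / (4 * n) * ((n / 2 : ℕ) * (n - n / 2 : ℕ)) := by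
      field_simp
    rw [e1, e2]
    exact mul_le_mul_of_nonneg_left hprod (by positivity)
  have := mul_le_mul_of_nonneg_right hgap.le hn0.le
  linarith

theorem mu_gap {c : ℝ} (hc : 0 < c) :
    mu c 0 (1 / 2) (1 / 2) + c ^ 3 / 2 ^ 5 * Real.exp (-7 * c) ≤ mu c 0 1 0 := by
  have hle : ∀ bl br, IsBoundedUnder (· ≤ ·) atTop (fun n : ℕ => muN c 0 bl br n) := fun bl br =>
    isBoundedUnder_of ⟨1, fun n => (muN_mem_Icc c 0 bl br n).2⟩
  have hge : ∀ bl br, IsBoundedUnder (· ≥ ·) atTop (fun n : ℕ => muN c 0 bl br n) := fun bl br =>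
    isBoundedUnder_of ⟨0, fun n => (muN_mem_Icc c 0 bl br n).1⟩
  have hcob : IsCoboundedUnder (· ≤ ·) atTop (fun n : ℕ => muN c 0 (1 / 2) (1 / 2) n) :=
    (hge _ _).isCoboundedUnder_le
  rw [mu, ← limsup_add_const atTop _ _ (hle _ _) hcob]
  -- The gap holds for each large n separately, so it survives the upper limits although convergence
  -- is not known.
  refine limsup_le_limsup (eventually_muN_gap hc) ?_ (hle _ _)
  exact IsBoundedUnder.isCoboundedUnder_le
    (isBoundedUnder_of ⟨0, fun n => add_nonneg (muN_mem_Icc c 0 _ _ n).1 (by positivity)⟩)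

end Law

end Flexibility

theorem theorem2 (αf α B : ℝ) (hα_nonneg : 0 ≤ α) (hαf : α < αf) (hB : B = 1) (hα : α = 0) :
    Flexibility.mu αf α B 0 - Flexibility.mu αf α (B / 2) (B / 2) ≥
        αf ^ 3 / 2 ^ 5 * Real.exp (-7 * αf) ∧
      Flexibility.mu αf α (B / 2) (B / 2) < Flexibility.mu αf α B 0 := by
  subst hB hα
  have h := Flexibility.mu_gap hαf
  have hpos : 0 < αf ^ 3 / 2 ^ 5 * Real.exp (-7 * αf) := by positivity
  exact ⟨by linarith, by linarith⟩
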